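/- Let $d\ge 0$ be an integer and let $r,s>0$ be real numbers. For $\lambda=(\lambda_1,\dots,\lambda_d)\in(0,\infty)^d$ and $t>0$ let $\mathrm{Po}(t\lambda)$ be the distribution on $\mathbb{N}^d$, $\mathbb{N}=\{0,1,2,\dots\}$, whose coordinates are independent, the $i$-th being Poisson with mean $t\lambda_i$. The random vectors $x\sim\mathrm{Po}(r\lambda)$ and $y\sim\mathrm{Po}(s\lambda)$ are independent; write $p(x\mid\lambda)$ and $p(y\mid\lambda)$ for their probability mass functions. A predictive distribution $q(y;x)$ assigns to every $x\in\mathbb{N}^d$ a probability mass function $y\mapsto q(y;x)$ on $\mathbb{N}^d$; its Kullback–Leibler (KL) risk at $\lambda$ is $$R(\lambda,q)=\sum_{x\in\mathbb{N}^d}p(x\mid\lambda)\sum_{y\in\mathbb{N}^d}p(y\mid\lambda)\log\frac{p(y\mid\lambda)}{q(y;x)}\in[0,\infty].$$ Then for every predictive distribution $q(y;x)$ and every $\varepsilon>0$ there exists $\lambda\in(0,\infty)^d$ such that $$R(\lambda,q)>\tfrac12\,d\,\log\frac{r+s}{r}-\varepsilon .$$ -/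

import Mathlib

open MeasureTheory ProbabilityTheory InformationTheory
open scoped NNReal ENNReal

/-- The multivariate Poisson distribution `Po(t λ)` on `ℕ ^ d`: the coordinates are independent
and the `i`-th one is Poisson with mean `t * λ i`. -/
noncomputable def multiPoisson {d : ℕ} (t : ℝ≥0) (lam : Fin d → ℝ≥0) : Measure (Fin d → ℕ) :=
  Measure.pi fun i => poissonMeasure (t * lam i)

/-- A predictive distribution `q(y; x)`: to every observation `x` it assigns a probability mass
function on the possible future outcomes `y`. -/
abbrev PredictiveDistribution (d : ℕ) : Type := (Fin d → ℕ) → PMF (Fin d → ℕ)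

/-- The Kullback–Leibler loss `D(p(y | λ), q(y; x)) = ∑_y p(y | λ) log (p(y | λ) / q(y; x))` of `q`
at the observation `x`, where `y ∼ Po(s λ)`. It takes values in `[0, ∞]`. -/
noncomputable def klLoss {d : ℕ} (s : ℝ≥0) (q : PredictiveDistribution d) (lam : Fin d → ℝ≥0)
    (x : Fin d → ℕ) : ℝ≥0∞ :=
  klDiv (multiPoisson s lam) (q x).toMeasure

/-- The Kullback–Leibler risk of `q` at `λ`: the expectation of the loss over `x ∼ Po(r λ)`. It
takes values in `[0, ∞]`. -/
noncomputable def klRisk {d : ℕ} (r s : ℝ≥0) (q : PredictiveDistribution d)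
    (lam : Fin d → ℝ≥0) : ℝ≥0∞ :=
  ∫⁻ x, klLoss s q lam x ∂(multiPoisson r lam)

/-! Let `k = (r + s) / r` and suppose the risk is everywhere at most `b = (d / 2) log k - ε`. Call
the divergence of the true law from a fixed `Q` the redundancy of `Q`. At time `r`, some `Q` has
bounded redundancy over `λ ∈ (0, 1]^d`. Predicting `y` by `q` turns `Q` into a distribution for `x +
y ∼ Po((r + s)λ)` at extra cost at most `b` (`exists_klDiv_add_le`). Rescaling `λ` and iterating
gives redundancy at most `C + n b` at time `T = r k ^ n` (`exists_universal_of_klRisk_le`).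

Poisson means are resolved to order `√T`, so `Po(Tλ)` distinguishes about `M ^ d` grid points with
`M` of order `√T`. Every `Q` therefore has redundancy about `d log M ≈ n (d / 2) log k` at one of
them (`exists_le_klDiv_multiPoisson`), a contradiction for large `n`. -/

/-! ### Bounds on the Kullback–Leibler divergence -/

/-- For a countable discrete first factor, the conditional Kullback-Leibler divergence of two
kernels is at most the average of the divergences of their fibres. -/
lemma klDiv_compProd_le_lintegral {α β : Type*} [MeasurableSpace α] [MeasurableSpace β]
    [Countable α] [MeasurableSingletonClass α] (μ : Measure α) [IsFiniteMeasure μ]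
    (κ η : Kernel α β) [IsMarkovKernel κ] [IsMarkovKernel η] :
    klDiv (μ ⊗ₘ κ) (μ ⊗ₘ η) ≤ ∫⁻ x, klDiv (κ x) (η x) ∂μ := by
  by_cases htop : ∫⁻ x, klDiv (κ x) (η x) ∂μ = ∞
  · simp [htop]
  have hac : ∀ᵐ x ∂μ, κ x ≪ η x := by
    filter_upwards [ae_lt_top (measurable_of_countable _) htop] with x hx
    by_contra h
    simp [klDiv_of_not_ac h] at hx
  have hcomp : μ ⊗ₘ κ ≪ μ ⊗ₘ η := Measure.AbsolutelyContinuous.compProd_right hac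
  -- Countability of the first factor makes the fibrewise densities jointly measurable.
  set f : α × β → ℝ≥0∞ := fun p ↦ (κ p.1).rnDeriv (η p.1) p.2 with hf_def
  have hf : Measurable f :=
    measurable_from_prod_countable_right fun x ↦ Measure.measurable_rnDeriv (κ x) (η x)
  have hdens : μ ⊗ₘ κ = (μ ⊗ₘ η).withDensity f := by
    ext t ht
    rw [withDensity_apply _ ht, ← lintegral_indicator ht,
      Measure.lintegral_compProd (hf.indicator ht), Measure.compProd_apply ht]
    refine lintegral_congr_ae ?_
    filter_upwards [hac] with x hx
    have hslice : MeasurableSet (Prod.mk x ⁻¹' t) := measurable_prodMk_left ht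
    rw [← Measure.setLIntegral_rnDeriv hx, ← lintegral_indicator hslice]
    rfl
  have hrn : (μ ⊗ₘ κ).rnDeriv (μ ⊗ₘ η) =ᵐ[μ ⊗ₘ η] f := by
    rw [hdens]
    exact Measure.rnDeriv_withDensity _ hf
  rw [klDiv_eq_lintegral_klFun_of_ac hcomp,
    lintegral_congr_ae (g := fun p ↦ ENNReal.ofReal (klFun (f p).toReal))
      (by filter_upwards [hrn] with p hp; rw [hp]),
    Measure.lintegral_compProd (by fun_prop)]
  refine (lintegral_congr_ae ?_).le
  filter_upwards [hac] with x hx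
  rw [klDiv_eq_lintegral_klFun_of_ac hx]

/-- A lower bound for the Kullback-Leibler divergence by the masses of a single set. -/
lemma mul_measure_le_klDiv_add {α : Type*} [MeasurableSpace α] (P Q : Measure α)
    [IsFiniteMeasure P] [IsFiniteMeasure Q] (A : Set α) (c : ℝ) :
    ENNReal.ofReal c * P A ≤ klDiv P Q + ENNReal.ofReal (Real.exp c) * Q A := by
  by_cases hac : P ≪ Q
  swap
  · simp [klDiv_of_not_ac hac]
  rw [klDiv_eq_lintegral_klFun_of_ac hac, ← Measure.setLIntegral_rnDeriv hac,
    ← lintegral_const_mul _ (Measure.measurable_rnDeriv _ _), ← setLIntegral_const]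
  refine le_trans ?_ (add_le_add_left (setLIntegral_le_lintegral A _) _)
  rw [← lintegral_add_right _ measurable_const]
  refine lintegral_mono_ae (ae_restrict_of_ae ?_)
  filter_upwards [P.rnDeriv_lt_top Q] with x hx
  obtain ⟨u, hu⟩ : ∃ u : ℝ≥0, P.rnDeriv Q x = u := ⟨_, (ENNReal.coe_toNNReal hx.ne).symm⟩
  have hu0 : (0 : ℝ) ≤ u := u.2
  rw [hu, ENNReal.coe_toReal, ← ENNReal.ofReal_coe_nnreal, ← ENNReal.ofReal_mul' hu0,
    ← ENNReal.ofReal_add (klFun_nonneg hu0) (Real.exp_pos c).le]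
  -- Young's inequality `c u ≤ u log u - u + exp c`; for `u > 0` it is `1 + z ≤ exp z` at `z = c -
  -- log u`.
  refine ENNReal.ofReal_le_ofReal ?_
  rw [klFun]
  rcases hu0.eq_or_lt with h | h
  · rw [← h]
    simp only [mul_zero, zero_mul, zero_add, sub_zero]
    positivity
  · have h1 := Real.add_one_le_exp (c - Real.log u)
    rw [Real.exp_sub, Real.exp_log h, le_div_iff₀ h] at h1
    nlinarith

/-- If `P` is dominated by a multiple of `Q`, then `klDiv P Q` is bounded in terms of the factor. -/
lemma klDiv_le_of_le_smul {α : Type*} [MeasurableSpace α] (P Q : Measure α)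
    [IsFiniteMeasure P] [IsProbabilityMeasure Q] (K : ℝ≥0) (h : P ≤ (K : ℝ≥0∞) • Q) :
    klDiv P Q ≤ ((1 + K ^ 2 : ℝ≥0) : ℝ≥0∞) := by
  have hac : P ≪ Q := (Measure.absolutelyContinuous_of_le h).trans
    (Measure.smul_absolutelyContinuous)
  have hle : P.rnDeriv Q ≤ᵐ[Q] fun _ ↦ (K : ℝ≥0∞) := by
    refine ae_le_of_forall_setLIntegral_le_of_sigmaFinite₀
      (Measure.measurable_rnDeriv _ _).aemeasurable ?_
    intro s hs _
    rw [Measure.setLIntegral_rnDeriv hac, setLIntegral_const]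
    exact h s
  rw [klDiv_eq_lintegral_klFun_of_ac hac]
  calc _ ≤ ∫⁻ _, ((1 + K ^ 2 : ℝ≥0) : ℝ≥0∞) ∂Q := by
        refine lintegral_mono_ae ?_
        filter_upwards [hle] with x hx
        rw [← ENNReal.ofReal_coe_nnreal]
        refine ENNReal.ofReal_le_ofReal ?_
        have hu : (P.rnDeriv Q x).toReal ≤ K := ENNReal.toReal_mono ENNReal.coe_ne_top hx
        have hu0 : 0 ≤ (P.rnDeriv Q x).toReal := ENNReal.toReal_nonneg
        set u := (P.rnDeriv Q x).toReal
        rw [klFun]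
        push_cast
        rcases hu0.eq_or_lt with h | h
        · rw [← h]
          simp only [zero_mul, zero_add, sub_zero]
          nlinarith [sq_nonneg (K : ℝ)]
        · have := Real.log_le_sub_one_of_pos h
          nlinarith
    _ = _ := by simp

/-! ### Poisson distributions -/

instance isProbabilityMeasure_multiPoisson {d : ℕ} (t : ℝ≥0) (lam : Fin d → ℝ≥0) :
    IsProbabilityMeasure (multiPoisson t lam) := by
  unfold multiPoisson
  infer_instance

lemma multiPoisson_mul {d : ℕ} (t k : ℝ≥0) (lam : Fin d → ℝ≥0) :
    multiPoisson (t * k) lam = multiPoisson t (fun i ↦ k * lam i) := by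
  simp only [multiPoisson, mul_assoc]

/-- The multivariate Poisson distributions form a convolution semigroup. -/
lemma map_add_prod_multiPoisson {d : ℕ} (r s : ℝ≥0) (lam : Fin d → ℝ≥0) :
    ((multiPoisson r lam).prod (multiPoisson s lam)).map (fun p ↦ p.1 + p.2) =
      multiPoisson (r + s) lam := by
  have h1 : (multiPoisson r lam).prod (multiPoisson s lam) =
      (Measure.pi fun i ↦ (poissonMeasure (r * lam i)).prod (poissonMeasure (s * lam i))).map
        (fun x ↦ (fun i ↦ (x i).1, fun i ↦ (x i).2)) := by
    refine Measure.ext_of_singleton fun p ↦ ?_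
    obtain ⟨u, v⟩ := p
    rw [Measure.map_apply (by fun_prop) (measurableSet_singleton _)]
    have hpre : (fun x : Fin d → ℕ × ℕ ↦ ((fun i ↦ (x i).1, fun i ↦ (x i).2) :
        (Fin d → ℕ) × (Fin d → ℕ))) ⁻¹' {(u, v)} = {fun i ↦ (u i, v i)} := by
      ext x
      simp only [Set.mem_preimage, Set.mem_singleton_iff, Prod.ext_iff, funext_iff]
      exact ⟨fun h i ↦ ⟨h.1 i, h.2 i⟩, fun h ↦ ⟨fun i ↦ (h i).1, fun i ↦ (h i).2⟩⟩
    rw [hpre, Measure.pi_singleton, ← Set.singleton_prod_singleton, Measure.prod_prod,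
      multiPoisson, multiPoisson, Measure.pi_singleton, Measure.pi_singleton,
      ← Finset.prod_mul_distrib]
    refine Finset.prod_congr rfl fun i _ ↦ ?_
    rw [← Set.singleton_prod_singleton, Measure.prod_prod]
  rw [h1, Measure.map_map (by fun_prop) (by fun_prop)]
  have h2 : ((fun p : (Fin d → ℕ) × (Fin d → ℕ) ↦ p.1 + p.2) ∘
      fun x : Fin d → ℕ × ℕ ↦ (fun i ↦ (x i).1, fun i ↦ (x i).2)) =
      fun x i ↦ (fun q : ℕ × ℕ ↦ q.1 + q.2) (x i) := rfl
  have (i : Fin d) : IsProbabilityMeasure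
      (((poissonMeasure (r * lam i)).prod (poissonMeasure (s * lam i))).map
        (fun q : ℕ × ℕ ↦ q.1 + q.2)) :=
    Measure.isProbabilityMeasure_map (by fun_prop)
  rw [h2, Measure.pi_map_pi (f := fun _ (q : ℕ × ℕ) ↦ q.1 + q.2) (fun i ↦ by fun_prop),
    multiPoisson]
  congr 1
  ext1 i
  rw [add_mul, ← poissonMeasure_conv_poissonMeasure]
  rfl

/-- In each coordinate the ratio of masses is `exp (r (1 - λ)) λ ^ x ≤ exp r`. Thus `Po(r)` at `λ =
1` serves the whole cube and starts the induction. -/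
lemma multiPoisson_le_smul {d : ℕ} (r : ℝ≥0) (lam : Fin d → ℝ≥0) (hlam : ∀ i, lam i ≤ 1) :
    multiPoisson r lam ≤
      ((Real.toNNReal (Real.exp r) ^ d : ℝ≥0) : ℝ≥0∞) • multiPoisson r (fun _ ↦ 1) := by
  refine Measure.le_iff'.2 fun t ↦ ?_
  have hsing (x : Fin d → ℕ) : multiPoisson r lam {x} ≤
      ((Real.toNNReal (Real.exp r) ^ d : ℝ≥0) : ℝ≥0∞) * multiPoisson r (fun _ ↦ 1) {x} := by
    have hK : ((Real.toNNReal (Real.exp r) ^ d : ℝ≥0) : ℝ≥0∞) =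
        ∏ _i : Fin d, ENNReal.ofReal (Real.exp r) := by
      simp [ENNReal.ofReal]
    rw [hK, multiPoisson, multiPoisson, Measure.pi_singleton, Measure.pi_singleton,
      ← Finset.prod_mul_distrib]
    refine Finset.prod_le_prod' fun i _ ↦ ?_
    rw [poissonMeasure_singleton, poissonMeasure_singleton,
      ← ENNReal.ofReal_mul (Real.exp_pos _).le]
    refine ENNReal.ofReal_le_ofReal ?_
    have h1 : ((r * lam i : ℝ≥0) : ℝ) ^ x i ≤ (r : ℝ) ^ x i := by
      refine pow_le_pow_left₀ (NNReal.coe_nonneg _) ?_ _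
      exact_mod_cast mul_le_of_le_one_right' (hlam i)
    have h2 : Real.exp (-((r * lam i : ℝ≥0) : ℝ)) ≤ 1 :=
      Real.exp_le_one_iff.2 (neg_nonpos.2 (NNReal.coe_nonneg _))
    rw [mul_one, mul_div_assoc, mul_div_assoc, ← mul_assoc, ← Real.exp_add, add_neg_cancel,
      Real.exp_zero]
    gcongr
  rw [Measure.smul_apply, smul_eq_mul,
    ← Measure.tsum_indicator_apply_singleton _ t t.to_countable.measurableSet,
    ← Measure.tsum_indicator_apply_singleton _ t t.to_countable.measurableSet,
    ← ENNReal.tsum_mul_left]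
  refine ENNReal.tsum_le_tsum fun x ↦ ?_
  by_cases hx : x ∈ t
  · simpa only [Set.indicator_of_mem hx] using hsing x
  · simp [hx]

lemma lintegral_sub_sq_poissonMeasure (a : ℝ≥0) :
    ∫⁻ n : ℕ, ENNReal.ofReal (((n : ℝ) - a) ^ 2) ∂(poissonMeasure a) = a := by
  set p : ℕ → ℝ := fun n ↦ Real.exp (-a) * (a : ℝ) ^ n / (n.factorial : ℝ) with hp
  have h0 : HasSum p 1 := hasSum_one_poissonMeasure a
  -- This recursion yields the first two moments by shifting the series by one.
  have hstep (n : ℕ) : ((n + 1 : ℕ) : ℝ) * p (n + 1) = a * p n := by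
    simp only [hp, Nat.factorial_succ, Nat.cast_mul]
    have : (n.factorial : ℝ) ≠ 0 := by positivity
    have : ((n + 1 : ℕ) : ℝ) ≠ 0 := by positivity
    field_simp
    ring
  have h1 : HasSum (fun n : ℕ ↦ (n : ℝ) * p n) a := by
    refine (hasSum_nat_add_iff' (f := fun n : ℕ ↦ (n : ℝ) * p n) 1).1 ?_
    simpa only [hstep, mul_one, Finset.sum_range_one, Nat.cast_zero, zero_mul, sub_zero]
      using h0.mul_left (a : ℝ)
  have h2 : HasSum (fun n : ℕ ↦ (n : ℝ) ^ 2 * p n) (a * (a + 1)) := by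
    refine (hasSum_nat_add_iff' (f := fun n : ℕ ↦ (n : ℝ) ^ 2 * p n) 1).1 ?_
    have h := (h1.add h0).mul_left (a : ℝ)
    have heq : (fun n : ℕ ↦ ((n + 1 : ℕ) : ℝ) ^ 2 * p (n + 1)) =
        fun n : ℕ ↦ (a : ℝ) * (n * p n + p n) := by
      ext n
      have := hstep n
      push_cast at this ⊢
      linear_combination ((n : ℝ) + 1) * this
    simpa only [heq, Finset.sum_range_one, Nat.cast_zero, ne_eq, OfNat.ofNat_ne_zero,
      not_false_eq_true, zero_pow, zero_mul, sub_zero] using h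
  have h3 : HasSum (fun n : ℕ ↦ ((n : ℝ) - a) ^ 2 * p n) a := by
    have h := (h2.sub (h1.mul_left (2 * (a : ℝ)))).add (h0.mul_left ((a : ℝ) ^ 2))
    convert! h using 1
    · ext n; ring
    · ring
  have hp0 (n : ℕ) : 0 ≤ p n := by positivity
  rw [lintegral_countable']
  calc _ = ∑' n : ℕ, ENNReal.ofReal (((n : ℝ) - a) ^ 2 * p n) := by
        refine tsum_congr fun n ↦ ?_
        rw [poissonMeasure_singleton, ENNReal.ofReal_mul (sq_nonneg _)]
    _ = _ := by
        rw [← ENNReal.ofReal_tsum_of_nonneg (fun n ↦ mul_nonneg (sq_nonneg _) (hp0 n)) h3.summable,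
          h3.tsum_eq, ENNReal.ofReal_coe_nnreal]

/-- Chebyshev's inequality for the Poisson distribution. -/
lemma poissonMeasure_abs_sub_lt_ge (a : ℝ≥0) {c : ℝ} (hc : 0 < c) :
    ENNReal.ofReal (1 - a / c ^ 2) ≤ poissonMeasure a {n : ℕ | |(n : ℝ) - a| < c} := by
  have h := mul_meas_ge_le_lintegral (μ := poissonMeasure a)
    (f := fun n : ℕ ↦ ENNReal.ofReal (((n : ℝ) - a) ^ 2)) (measurable_of_countable _)
    (ENNReal.ofReal (c ^ 2))
  rw [lintegral_sub_sq_poissonMeasure] at h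
  have hset : {n : ℕ | ENNReal.ofReal (c ^ 2) ≤ ENNReal.ofReal (((n : ℝ) - a) ^ 2)} =
      {n : ℕ | |(n : ℝ) - a| < c}ᶜ := by
    ext n
    rw [Set.mem_ofPred_eq, Set.mem_compl_iff, Set.mem_ofPred_eq, not_lt,
      ENNReal.ofReal_le_ofReal_iff (sq_nonneg _), sq_le_sq, abs_of_pos hc]
  have hc2 : ENNReal.ofReal (c ^ 2) ≠ 0 := by
    rw [ne_eq, ENNReal.ofReal_eq_zero, not_le]
    positivity
  rw [hset, mul_comm, ← ENNReal.le_div_iff_mul_le (.inl hc2) (.inl ENNReal.ofReal_ne_top),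
    prob_compl_eq_one_sub (Set.to_countable _).measurableSet, ← ENNReal.ofReal_coe_nnreal,
    ← ENNReal.ofReal_div_of_pos (by positivity)] at h
  rw [ENNReal.ofReal_sub _ (by positivity), ENNReal.ofReal_one]
  exact tsub_le_iff_tsub_le.1 h

/-! ### Upper bound: iterated prediction -/

/-- Prediction of `y` from `x` by `q` extends a universal distribution `Q` for `x` to one for
`x + y`; the redundancy grows by at most the risk of `q`. -/
lemma exists_klDiv_add_le {d : ℕ} (r s : ℝ≥0) (q : PredictiveDistribution d)
    (Q : Measure (Fin d → ℕ)) [IsProbabilityMeasure Q] :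
    ∃ Q' : Measure (Fin d → ℕ), IsProbabilityMeasure Q' ∧ ∀ lam : Fin d → ℝ≥0,
      klDiv (multiPoisson (r + s) lam) Q' ≤
        klDiv (multiPoisson r lam) Q + klRisk r s q lam := by
  let η : Kernel (Fin d → ℕ) (Fin d → ℕ) :=
    ⟨fun x ↦ (q x).toMeasure, measurable_of_countable _⟩
  have hη : IsMarkovKernel η := ⟨fun x ↦ PMF.toMeasure.isProbabilityMeasure (q x)⟩
  have hadd : Measurable fun p : (Fin d → ℕ) × (Fin d → ℕ) ↦ p.1 + p.2 :=
    measurable_of_countable _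
  -- The witness is the law of `x + y` with `x ∼ Q` and `y ∼ q(·; x)`. Data processing passes from
  -- the sum to the pair, and the chain rule splits the pair.
  refine ⟨(Q ⊗ₘ η).map (fun p ↦ p.1 + p.2), Measure.isProbabilityMeasure_map hadd.aemeasurable,
    fun lam ↦ ?_⟩
  rw [← map_add_prod_multiPoisson, ← Measure.compProd_const]
  refine (klDiv_map_le _ _ hadd).trans ?_
  rw [klDiv_compProd_eq_add]
  gcongr
  exact klDiv_compProd_le_lintegral _ _ _

/-- `Po((r + s) k ^ n λ)` is the law of `x + y` at the parameter `k ^ n λ`. This may leave the unit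
cube, so the risk bound is needed at all positive parameters. -/
lemma exists_universal_of_klRisk_le {d : ℕ} {r s : ℝ≥0} (hr : 0 < r)
    (q : PredictiveDistribution d) {B : ℝ≥0∞}
    (hB : ∀ lam : Fin d → ℝ≥0, (∀ i, 0 < lam i) → klRisk r s q lam ≤ B) :
    ∃ C : ℝ≥0, ∀ n : ℕ, ∃ Q : Measure (Fin d → ℕ), IsProbabilityMeasure Q ∧
      ∀ lam : Fin d → ℝ≥0, (∀ i, 0 < lam i) → (∀ i, lam i ≤ 1) →
        klDiv (multiPoisson (r * ((r + s) / r) ^ n) lam) Q ≤ C + n * B := by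
  refine ⟨1 + (Real.toNNReal (Real.exp r) ^ d) ^ 2, fun n ↦ ?_⟩
  induction n with
  | zero =>
    refine ⟨multiPoisson r (fun _ ↦ 1), inferInstance, fun lam _ h1 ↦ ?_⟩
    simpa only [pow_zero, mul_one, Nat.cast_zero, zero_mul, add_zero] using
      klDiv_le_of_le_smul _ _ _ (multiPoisson_le_smul r lam h1)
  | succ n ih =>
    obtain ⟨Q, _, hQ⟩ := ih
    obtain ⟨Q', hQ', h⟩ := exists_klDiv_add_le r s q Q
    refine ⟨Q', hQ', fun lam h0 h1 ↦ ?_⟩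
    have hk : 0 < ((r + s) / r) ^ n := pow_pos (div_pos (add_pos_of_pos_of_nonneg hr s.2) hr) n
    have e : r * ((r + s) / r) ^ (n + 1) = (r + s) * ((r + s) / r) ^ n := by
      rw [pow_succ]
      field_simp
    rw [e, multiPoisson_mul]
    refine (h _).trans ?_
    rw [← multiPoisson_mul]
    push_cast
    rw [add_mul, one_mul, ← add_assoc]
    exact add_le_add (by exact_mod_cast hQ lam h0 h1) (hB _ fun i ↦ mul_pos hk (h0 i))

/-! ### Lower bound: distinguishable grid points -/

/-- If `4 * M ^ 2 ≤ δ * T`, then every distribution has redundancy about `d * log M` at some of the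
`M ^ d` points of a grid, because these are distinguishable from an observation of `Po(T λ)`. -/
lemma exists_le_klDiv_multiPoisson {d : ℕ} {T : ℝ≥0} {M : ℕ} (hM : 0 < M) {δ : ℝ} (hδ0 : 0 < δ)
    (hδ1 : δ ≤ 1) (hT : 4 * (M : ℝ) ^ 2 ≤ δ * T) (Q : Measure (Fin d → ℕ))
    [IsProbabilityMeasure Q] :
    ∃ lam : Fin d → ℝ≥0, (∀ i, 0 < lam i) ∧ (∀ i, lam i ≤ 1) ∧
      ENNReal.ofReal ((1 - d * δ) * (d * Real.log M)) ≤ klDiv (multiPoisson T lam) Q + 1 := by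
  have hM' : (0 : ℝ) < M := by exact_mod_cast hM
  have hT0 : (0 : ℝ) < T := pos_of_mul_pos_right (lt_of_lt_of_le (by positivity) hT) hδ0.le
  let lam (f : Fin d → Fin M) (i : Fin d) : ℝ≥0 := (((f i : ℕ) + 1 : ℕ) : ℝ≥0) / M
  have hlam0 (f i) : 0 < lam f i := by positivity
  have hlam1 (f i) : lam f i ≤ 1 := by
    refine div_le_one_of_le₀ ?_ zero_le
    exact_mod_cast (f i).2
  have hlam (f : Fin d → Fin M) (i : Fin d) :
      ((T * lam f i : ℝ≥0) : ℝ) = T / M * ((f i : ℕ) + 1) := by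
    simp only [lam]
    push_cast
    ring
  -- The radius is half the spacing `T / M` of the means, so the boxes are disjoint. The variances
  -- are at most `T`, so Chebyshev loses at most `4 M ^ 2 / T ≤ δ` per coordinate.
  let A (f : Fin d → Fin M) : Set (Fin d → ℕ) :=
    Set.univ.pi fun i ↦ {n : ℕ | |(n : ℝ) - (T * lam f i : ℝ≥0)| < T / (2 * M)}
  have hmass (f) : ENNReal.ofReal (1 - d * δ) ≤ multiPoisson T (lam f) (A f) := by
    rw [multiPoisson, Measure.pi_pi]
    calc ENNReal.ofReal (1 - d * δ) ≤ ENNReal.ofReal ((1 - δ) ^ d) := by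
          refine ENNReal.ofReal_le_ofReal ?_
          have := one_add_mul_le_pow (a := -δ) (by linarith) d
          simpa [sub_eq_add_neg] using this
      _ = ∏ _i : Fin d, ENNReal.ofReal (1 - δ) := by
          simp [ENNReal.ofReal_pow (sub_nonneg.2 hδ1)]
      _ ≤ _ := by
          refine Finset.prod_le_prod' fun i _ ↦ le_trans (ENNReal.ofReal_le_ofReal ?_)
            (poissonMeasure_abs_sub_lt_ge _ (by positivity))
          have h1 : ((T * lam f i : ℝ≥0) : ℝ) ≤ T := by
            exact_mod_cast mul_le_of_le_one_right' (hlam1 f i)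
          rw [sub_le_sub_iff_left, div_le_iff₀ (by positivity)]
          refine h1.trans ?_
          rw [div_pow, mul_pow, ← mul_div_assoc, le_div_iff₀ (by positivity)]
          nlinarith
  have hdisj : Pairwise (Function.onFun Disjoint A) := by
    intro f g hfg
    refine Set.disjoint_left.2 fun z hzf hzg ↦ hfg (funext fun i ↦ ?_)
    have h1 := hzf i (Set.mem_univ i)
    have h2 := hzg i (Set.mem_univ i)
    rw [Set.mem_ofPred_eq, hlam, abs_lt] at h1 h2
    have hw : (0 : ℝ) < T / M := by positivity
    have hhalf : (T : ℝ) / (2 * M) = T / M / 2 := by ring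
    rw [hhalf] at h1 h2
    have h3 : ((f i : ℕ) : ℝ) < (g i : ℕ) + 1 := by
      by_contra! h
      nlinarith
    have h4 : ((g i : ℕ) : ℝ) < (f i : ℕ) + 1 := by
      by_contra! h
      nlinarith
    have h3' : (f i : ℕ) < (g i : ℕ) + 1 := by exact_mod_cast h3
    have h4' : (g i : ℕ) < (f i : ℕ) + 1 := by exact_mod_cast h4
    exact Fin.ext (by omega)
  have hMd : ((M : ℝ≥0∞) ^ d) ≠ 0 := pow_ne_zero _ (by exact_mod_cast hM.ne')
  have hMd' : ((M : ℝ≥0∞) ^ d) ≠ ∞ := ENNReal.pow_ne_top (ENNReal.natCast_ne_top M)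
  -- Pigeonhole over the `M ^ d` disjoint boxes.
  obtain ⟨f, hf⟩ : ∃ f, Q (A f) ≤ ((M : ℝ≥0∞) ^ d)⁻¹ := by
    have : Nonempty (Fin M) := ⟨⟨0, hM⟩⟩
    obtain ⟨f, -, hf⟩ := ENNReal.exists_le_of_sum_le (s := (Finset.univ : Finset (Fin d → Fin M)))
      Finset.univ_nonempty (f := fun f ↦ Q (A f)) (g := fun _ ↦ ((M : ℝ≥0∞) ^ d)⁻¹) (by
        have h := sum_measure_le_measure_univ (μ := Q) (s := Finset.univ) (t := A)
          (fun f _ ↦ (Set.to_countable _).measurableSet.nullMeasurableSet)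
          (fun f _ g _ hfg ↦ (hdisj hfg).aedisjoint)
        rw [measure_univ] at h
        simpa [ENNReal.mul_inv_cancel hMd hMd'] using h)
    exact ⟨f, hf⟩
  refine ⟨lam f, hlam0 f, hlam1 f, ?_⟩
  -- With `c = log (M ^ d)` the error term `exp c * Q (A f)` is at most `1`.
  have h := mul_measure_le_klDiv_add (multiPoisson T (lam f)) Q (A f) (d * Real.log M)
  have hc : ENNReal.ofReal (Real.exp (d * Real.log M)) = (M : ℝ≥0∞) ^ d := by
    rw [Real.exp_nat_mul, Real.exp_log hM', ENNReal.ofReal_pow hM'.le, ENNReal.ofReal_natCast]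
  rw [hc] at h
  have hlog : 0 ≤ d * Real.log M :=
    mul_nonneg d.cast_nonneg (Real.log_nonneg (by exact_mod_cast hM))
  calc _ = ENNReal.ofReal (d * Real.log M) * ENNReal.ofReal (1 - d * δ) := by
        rw [mul_comm, ENNReal.ofReal_mul hlog]
    _ ≤ ENNReal.ofReal (d * Real.log M) * multiPoisson T (lam f) (A f) := by
        gcongr
        exact hmass f
    _ ≤ _ := h
    _ ≤ _ := by
        gcongr
        exact (mul_le_mul_right hf _).trans (ENNReal.mul_inv_cancel hMd hMd').le

/-- Linear growth of `log M` along `M ^ 2 ≍ r * k ^ n` forces the slope `d / 2 * log k`. -/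
lemma exists_floor_sqrt_log_lt (d : ℕ) {r k ε : ℝ} (hr : 0 < r) (hk : 1 < k) (hε : 0 < ε)
    (C : ℝ) :
    ∃ (n M : ℕ) (δ : ℝ), 0 < M ∧ 0 < δ ∧ δ ≤ 1 ∧ 4 * (M : ℝ) ^ 2 ≤ δ * (r * k ^ n) ∧
      C + n * (0.5 * d * Real.log k - ε) < (1 - d * δ) * (d * Real.log M) := by
  have hL : 0 < Real.log k := Real.log_pos hk
  have hd0 : (0 : ℝ) ≤ d := d.cast_nonneg
  -- The first bound gives `d δ ≤ 1`. The second keeps the loss `n d ^ 2 δ log k / 2` below `n ε /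
  -- 2`; the other `n ε / 2` absorbs the constants.
  set δ : ℝ := min (1 / (d + 1)) (ε / (d ^ 2 * Real.log k + 1)) with hδ
  have hδ0 : 0 < δ := by positivity
  have hδd : d * δ ≤ 1 := by
    have : δ ≤ 1 / (d + 1) := min_le_left _ _
    rw [le_div_iff₀ (by positivity)] at this
    nlinarith
  have hδ1 : δ ≤ 1 :=
    (min_le_left _ _).trans (div_le_one_of_le₀ (by linarith) (by positivity))
  have hδε : d ^ 2 * δ * Real.log k ≤ ε := by
    have : δ ≤ ε / (d ^ 2 * Real.log k + 1) := min_le_right _ _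
    rw [le_div_iff₀ (by positivity)] at this
    nlinarith
  -- The `log 4` pays for the halving in `w` and for `⌊w⌋₊ ≥ w / 2`.
  set c₀ : ℝ := 0.5 * Real.log (δ * r) - Real.log 4 with hc₀
  have hpow := (tendsto_pow_atTop_atTop_of_one_lt hk).const_mul_atTop (mul_pos hδ0 hr)
  have hlin := (tendsto_natCast_atTop_atTop (R := ℝ)).const_mul_atTop (half_pos hε)
  obtain ⟨n, hn1, hn2⟩ := ((hpow.eventually_ge_atTop 4).and
    (hlin.eventually_gt_atTop (C - (1 - d * δ) * (d * c₀)))).exists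
  have hk0 : 0 < k := one_pos.trans hk
  have hX0 : 0 < δ * r * k ^ n := by positivity
  set w : ℝ := √(δ * r * k ^ n) / 2 with hw
  have hw1 : 1 ≤ w := by
    have : (2 : ℝ) ≤ √(δ * r * k ^ n) := Real.le_sqrt_of_sq_le (by linarith)
    linarith
  have hfl : (⌊w⌋₊ : ℝ) ≤ w := Nat.floor_le (by linarith)
  have hfl' : w / 2 ≤ ⌊w⌋₊ := by
    have h1 := Nat.lt_floor_add_one w
    have h2 : (1 : ℝ) ≤ ⌊w⌋₊ := by exact_mod_cast (Nat.one_le_floor_iff w).2 hw1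
    linarith
  refine ⟨n, ⌊w⌋₊, δ, Nat.floor_pos.2 hw1, hδ0, hδ1, ?_, ?_⟩
  · have : 4 * w ^ 2 = δ * (r * k ^ n) := by
      rw [hw, div_pow, Real.sq_sqrt hX0.le]
      ring
    rw [← this]
    gcongr
  · have hlog : c₀ + 0.5 * n * Real.log k ≤ Real.log ⌊w⌋₊ := by
      refine le_trans (le_of_eq ?_) (Real.log_le_log (by linarith) hfl')
      rw [hw, div_div, Real.log_div (by positivity) (by norm_num), Real.log_sqrt hX0.le,
        Real.log_mul (by positivity) (by positivity), Real.log_pow, hc₀]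
      norm_num
      ring
    have h1 : (1 - d * δ) * (d * (c₀ + 0.5 * n * Real.log k)) ≤
        (1 - d * δ) * (d * Real.log ⌊w⌋₊) := by
      have : 0 ≤ 1 - d * δ := sub_nonneg.2 hδd
      gcongr
    refine lt_of_lt_of_le ?_ h1
    have h2 := mul_le_mul_of_nonneg_left hδε (n.cast_nonneg (α := ℝ))
    nlinarith

theorem theorem2 (d : ℕ) (r s : ℝ≥0) (hr : 0 < r) (hs : 0 < s)
    (q : PredictiveDistribution d) (ε : ℝ) (hε : 0 < ε) :
    ∃ lam : Fin d → ℝ≥0, (∀ i, 0 < lam i) ∧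
      (((0.5 : ℝ) * (d : ℝ) * Real.log (((r : ℝ) + (s : ℝ)) / (r : ℝ)) - ε : ℝ) : EReal) <
        (klRisk r s q lam : EReal) := by
  by_contra! hcon
  set b : ℝ := 0.5 * (d : ℝ) * Real.log (((r : ℝ) + (s : ℝ)) / (r : ℝ)) - ε with hb
  -- Nonnegativity of the risk ensures that `ENNReal.ofReal b` does not truncate.
  have hb0 : 0 ≤ b := by
    have h := (EReal.coe_ennreal_nonneg _).trans (hcon (fun _ ↦ 1) fun _ ↦ one_pos)
    exact_mod_cast h
  have hB (lam : Fin d → ℝ≥0) (h0 : ∀ i, 0 < lam i) : klRisk r s q lam ≤ ENNReal.ofReal b := by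
    have h := hcon lam h0
    rwa [← max_eq_left hb0, ← EReal.coe_ennreal_ofReal, EReal.coe_ennreal_le_coe_ennreal_iff] at h
  obtain ⟨C, hC⟩ := exists_universal_of_klRisk_le hr q hB
  have hr' : (0 : ℝ) < r := hr
  have hk : 1 < ((r : ℝ) + s) / r := by
    rw [one_lt_div hr']
    exact lt_add_of_pos_right _ hs
  -- The extra `1` matches the error term of the grid bound.
  obtain ⟨n, M, δ, hM, hδ0, hδ1, hT, hlt⟩ := exists_floor_sqrt_log_lt d hr' hk hε (C + 1)
  obtain ⟨Q, _, hQ⟩ := hC n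
  obtain ⟨lam, h0, h1, h⟩ := exists_le_klDiv_multiPoisson (T := r * ((r + s) / r) ^ n) hM hδ0 hδ1
    (by push_cast; exact hT) Q
  have hle := h.trans (add_le_add_left (hQ lam h0 h1) 1)
  have hsum : (C : ℝ≥0∞) + n * ENNReal.ofReal b + 1 = ENNReal.ofReal (C + 1 + n * b) := by
    rw [ENNReal.ofReal_add (by positivity) (by positivity),
      ENNReal.ofReal_add (by positivity) one_pos.le, ENNReal.ofReal_mul n.cast_nonneg,
      ENNReal.ofReal_natCast, ENNReal.ofReal_coe_nnreal, ENNReal.ofReal_one]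
    ring
  rw [hsum, ENNReal.ofReal_le_ofReal_iff (by positivity)] at hle
  exact absurd hle (not_le.2 hlt)
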